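/- Let $\psi\in\mathbb{R}$, $-1<\theta<1$, $\sigma^2\ge 0$, and let $(\varepsilon_t)_{t\in\mathbb{Z}}$ be i.i.d. $\mathrm{N}(0,\sigma^2)$ random variables on a probability space. Then the equation $x_t=\psi+\theta x_{t-1}+\varepsilon_t$ a.s. ($t\in\mathbb{Z}$) has a strictly stationary solution $(x_t)_{t\in\mathbb{Z}}$ on that space, which is unique up to almost sure equality for each $t$. For an integer $k\ge 0$, define its $\beta$-mixing coefficients by $$\beta(k)=\sup_{t\in\mathbb{Z}}\mathbb{E}\Big[\sup_{A\in\sigma(x_s:\,s\ge t+k)}\big|\mathbb{P}(A\mid\sigma(x_s:\,s\le t))-\mathbb{P}(A)\big|\Big],$$ where the conditional probability is a regular version. Then the stationary solution is $\beta$-mixing, i.e. $\beta(k)\to0$ as $k\to\infty$, and for every integer $k\ge 1$ $$\beta(k)\le\frac{|\theta|^k}{2\sqrt{1-\theta^2}},$$ where, if $\theta\ne 0$, the right-hand side equals $(2\sqrt{1-\theta^2})^{-1}\exp(-k\log(1/|\theta|))$. Consequently $(x_t)_{t\in\mathbb{Z}}$ is a stationary $\beta$-mixing process with a common marginal distribution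 for which there exist $C_\beta,\gamma,\xi>0$ such that $\beta(k)\le C_\beta e^{-\gamma k^{\xi}}$ for all integers $k\ge1$. -/

import Mathlib

open MeasureTheory ProbabilityTheory Filter Topology
open scoped ENNReal NNReal

noncomputable section

namespace BetaMixing

variable {Ω S : Type*} [MeasurableSpace Ω] [MeasurableSpace S]

/-- Strict stationarity of a process indexed by `ℤ`: the law of the whole path
is invariant under every time shift. -/
def IsStationary (P : Measure Ω) (x : ℤ → Ω → S) : Prop :=
  ∀ h : ℤ, P.map (fun ω (t : ℤ) => x (t + h) ω) = P.map (fun ω (t : ℤ) => x t ω)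

/-- The path of the process up to time `t`; it generates the `σ`-algebra of the `x s`, `s ≤ t`. -/
def past (x : ℤ → Ω → S) (t : ℤ) (ω : Ω) : Set.Iic t → S := fun s => x s ω

/-- The path of the process from time `t` on; it generates the `σ`-algebra of the `x s`, `t ≤ s`. -/
def future (x : ℤ → Ω → S) (t : ℤ) (ω : Ω) : Set.Ici t → S := fun s => x s ω

variable [StandardBorelSpace S] [Nonempty S]

/-- The regular version of the conditional probability, given the past of the process up to
time `t`, of the event that the path from time `u` on lies in `B`. -/
def condProb (P : Measure Ω) [IsFiniteMeasure P] (x : ℤ → Ω → S) (t u : ℤ)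
    (B : Set (Set.Ici u → S)) (ω : Ω) : ℝ :=
  (condDistrib (future x u) (past x t) P (past x t ω)).real B

/-- `condProb` is a version of the conditional probability given the `σ`-algebra of the past. -/
theorem condProb_ae_eq (P : Measure Ω) [IsFiniteMeasure P] (x : ℤ → Ω → S)
    (hx : ∀ t, Measurable (x t)) (t u : ℤ) {B : Set (Set.Ici u → S)} (hB : MeasurableSet B) :
    condProb P x t u B =ᵐ[P] P⟦future x u ⁻¹' B |
      ⨆ s : Set.Iic t, MeasurableSpace.comap (x s) inferInstance⟧ := by
  have hm : (⨆ s : Set.Iic t, MeasurableSpace.comap (x s) inferInstance)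
      = MeasurableSpace.comap (past x t) inferInstance := by
    simp only [MeasurableSpace.pi, MeasurableSpace.comap_iSup, MeasurableSpace.comap_comp]
    rfl
  rw [hm]
  exact condDistrib_ae_eq_condExp (measurable_pi_lambda _ fun s => hx s)
    (measurable_pi_lambda _ fun s => hx s) hB

/-- The `k`-th `β`-mixing coefficient
`sup_t E [ sup_A |P(A | past up to t) - P(A)| ]`. The inner supremum is over the events `A` of the
`σ`-algebra generated by the `x s`, `s ≥ t + k`, that is, over the events that the path from
time `t + k` on lies in a measurable set `B`. -/
def betaCoeff (P : Measure Ω) [IsFiniteMeasure P] (x : ℤ → Ω → S) (k : ℕ) : ℝ≥0∞ :=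
  ⨆ t : ℤ, ∫⁻ ω, ⨆ (B : Set (Set.Ici (t + (k : ℤ)) → S)) (_ : MeasurableSet B),
    ENNReal.ofReal |condProb P x t (t + k) B ω - P.real (future x (t + k) ⁻¹' B)| ∂P

/-- The process is `β`-mixing if its coefficients tend to zero. -/
def IsBetaMixing (P : Measure Ω) [IsFiniteMeasure P] (x : ℤ → Ω → S) : Prop :=
  Tendsto (fun k : ℕ => betaCoeff P x k) atTop (𝓝 0)

/-- A stationary process with a common marginal that is `β`-mixing with
`β(k) ≤ C exp(-γ k ^ ξ)`, `k ≥ 1`, for some `C, γ, ξ > 0`. -/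
structure IsExpBetaMixing (P : Measure Ω) [IsFiniteMeasure P] (x : ℤ → Ω → S) : Prop where
  stationary : IsStationary P x
  marginal : ∃ ν : Measure S, IsProbabilityMeasure ν ∧ ∀ t, HasLaw (x t) ν P
  mixing : IsBetaMixing P x
  rate : ∃ C γ ξ : ℝ, 0 < C ∧ 0 < γ ∧ 0 < ξ ∧
    ∀ k : ℕ, 1 ≤ k → betaCoeff P x k ≤ ENNReal.ofReal (C * Real.exp (-γ * (k : ℝ) ^ ξ))

/-- `x` is a stationary solution of `x_t = ψ + θ x_{t-1} + ε_t`. -/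
structure IsStationaryAR1 (P : Measure Ω) (ψ θ : ℝ) (ε x : ℤ → Ω → ℝ) : Prop where
  measurable : ∀ t, Measurable (x t)
  stationary : IsStationary P x
  recursion : ∀ t, ∀ᵐ ω ∂P, x t ω = ψ + θ * x (t - 1) ω + ε t ω

end BetaMixing

end

noncomputable section

namespace BetaMixing

/-! Put `ρ = θ ^ k`, `m = ψ / (1 - θ)`, `τ = σ² / (1 - θ²)`. The past up to `t` is independent of
the later innovations, so given the past `x (t + k)` has law `N(m + ρ (x t - m), (1 - ρ²) τ)`,
against `N(m, τ)` unconditionally. The path from `t + k` on is a fixed function of `x (t + k)` and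
of innovations that are independent of it under both laws. Hence the inner supremum is at most the
total variation distance of two product laws differing only in the first factor, which is controlled
by the density `r` of one Gaussian against the other (`abs_prod_sub_prod_le`).

Averaging over `x t`, Cauchy–Schwarz gives `E|r - 1| ≤ √(E r² - 1)`, and completing the square gives
`E r² = 1 / (1 - ρ²)`. This yields `|ρ| / (2 √(1 - ρ²))` (`exists_gaussian_tv_bound`), and `ρ² ≤ θ²`
for `k ≥ 1`.

Existence comes from the series `∑ θ ^ j ε (t - j)`, uniqueness from the contraction by `θ ^ n`
combined with stationarity. Uniqueness also serves the mixing bound: it makes every stationary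
solution causal, which is where the independence of past and later innovations comes from. -/

/-! ### Total variation of product measures -/

theorem measureReal_prod_eq_integral {α β : Type*} [MeasurableSpace α] [MeasurableSpace β]
    (μ : Measure α) [IsFiniteMeasure μ] (η : Measure β) [IsFiniteMeasure η]
    {C : Set (α × β)} (hC : MeasurableSet C) :
    (μ.prod η).real C = ∫ y, η.real (Prod.mk y ⁻¹' C) ∂μ := by
  rw [Measure.real, Measure.prod_apply hC, ← integral_toReal]
  · rfl
  · exact (measurable_measure_prodMk_left hC).aemeasurable
  · exact ae_of_all _ fun _ => measure_lt_top _ _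

/-- The total variation distance of two product measures with a common second factor is at most
half the `L¹` distance of the densities of the first factors. -/
theorem abs_prod_sub_prod_le {α β : Type*} [MeasurableSpace α] [MeasurableSpace β]
    (ν : Measure α) [IsProbabilityMeasure ν] (η : Measure β) [IsProbabilityMeasure η]
    {r : α → ℝ} (hr : Measurable r) (hr0 : ∀ y, 0 ≤ r y)
    {μ : Measure α} [IsProbabilityMeasure μ] (hμ : μ = ν.withDensity fun y => ENNReal.ofReal (r y))
    {C : Set (α × β)} (hC : MeasurableSet C) :
    |(μ.prod η).real C - (ν.prod η).real C| ≤ (∫ y, |r y - 1| ∂ν) / 2 := by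
  have hlin : ∫⁻ y, ENNReal.ofReal (r y) ∂ν = 1 := by
    simpa [hμ] using measure_univ (μ := μ)
  have hri : Integrable r ν := by
    refine ⟨hr.aestronglyMeasurable, ?_⟩
    rw [hasFiniteIntegral_iff_ofReal (ae_of_all _ hr0), hlin]
    exact ENNReal.one_lt_top
  have hr1 : ∫ y, r y ∂ν = 1 := by
    rw [integral_eq_lintegral_of_nonneg_ae (ae_of_all _ hr0) hr.aestronglyMeasurable, hlin]
    simp
  set h : α → ℝ := fun y => η.real (Prod.mk y ⁻¹' C) with hh
  have hm : Measurable h := (measurable_measure_prodMk_left hC).ennreal_toReal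
  have hh0 : ∀ y, 0 ≤ h y := fun y => measureReal_nonneg
  have hh1 : ∀ y, h y ≤ 1 := fun y => measureReal_le_one
  have hhi : Integrable h ν := Integrable.of_bound hm.aestronglyMeasurable 1
    (ae_of_all _ fun y => by rw [Real.norm_of_nonneg (hh0 y)]; exact hh1 y)
  have hrh : Integrable (fun y => r y * h y) ν :=
    hri.mul_bdd (c := 1) hm.aestronglyMeasurable
      (ae_of_all _ fun y => by rw [Real.norm_of_nonneg (hh0 y)]; exact hh1 y)
  have e1 : (μ.prod η).real C = ∫ y, r y * h y ∂ν := by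
    rw [measureReal_prod_eq_integral _ _ hC, hμ,
      integral_withDensity_eq_integral_toReal_smul (by fun_prop) (by simp)]
    refine integral_congr_ae (ae_of_all _ fun y => ?_)
    simp [ENNReal.toReal_ofReal (hr0 y), hh]
  have e2 : (ν.prod η).real C = ∫ y, h y ∂ν := measureReal_prod_eq_integral _ _ hC
  -- Since `r - 1` has integral zero, `h` may be centred at `1 / 2`; then `|h - 1 / 2| ≤ 1 / 2`,
  -- which is the source of the factor one half.
  have e3 : (μ.prod η).real C - (ν.prod η).real C = ∫ y, (r y - 1) * (h y - 1 / 2) ∂ν := by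
    have : ∀ y, (r y - 1) * (h y - 1 / 2) = (r y * h y - h y) - (r y - 1) / 2 := fun y => by ring
    simp_rw [this]
    have hd : Integrable (fun y => r y * h y - h y) ν := hrh.sub hhi
    have hd' : Integrable (fun y => (r y - 1) / 2) ν := (hri.sub (integrable_const 1)).div_const 2
    rw [integral_sub hd hd', integral_sub hrh hhi, integral_div, integral_sub hri (integrable_const 1), hr1, e1, e2]
    simp
  rw [e3, ← integral_div]
  refine (abs_integral_le_integral_abs).trans
    (integral_mono_of_nonneg (ae_of_all _ fun _ => abs_nonneg _)
      ((hri.sub (integrable_const 1)).abs.div_const 2) (ae_of_all _ fun y => ?_))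
  simp only
  rw [abs_mul, div_eq_mul_one_div |r y - 1|]
  refine mul_le_mul_of_nonneg_left ?_ (abs_nonneg _)
  rw [abs_le]
  constructor <;> linarith [hh0 y, hh1 y]

/-! ### The Gaussian transition density and its χ² distance from one -/

/-- Completing the square in `y`: the integrand of the second moment is, up to a constant, a
bivariate Gaussian density, split into the marginal of `x` (variance `w₂`) and the conditional law
of `y` (variance `w₁`). As `w₁ w₂ = τ²`, the constant left over is `τ / v = 1 / (1 - ρ²)`. -/
theorem gaussianPDFReal_sq_div_mul {μ ρ : ℝ} (hρ : |ρ| < 1) {τ v w₁ w₂ : ℝ≥0} (hτ : τ ≠ 0)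
    (hv : (v : ℝ) = (1 - ρ ^ 2) * τ) (hw₁ : (w₁ : ℝ) = τ * (1 - ρ ^ 2) / (1 + ρ ^ 2))
    (hw₂ : (w₂ : ℝ) = τ * (1 + ρ ^ 2) / (1 - ρ ^ 2)) (x y : ℝ) :
    gaussianPDFReal μ τ x * (gaussianPDFReal μ τ y *
        (gaussianPDFReal (μ + ρ * (x - μ)) v y / gaussianPDFReal μ τ y) ^ 2) =
      1 / (1 - ρ ^ 2) * (gaussianPDFReal μ w₂ x *
        gaussianPDFReal (μ + 2 * ρ * (x - μ) / (1 + ρ ^ 2)) w₁ y) := by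
  have h1 : 0 < 1 - ρ ^ 2 := by
    have := (sq_lt_one_iff_abs_lt_one ρ).2 hρ
    linarith
  have h2 : 0 < 1 + ρ ^ 2 := by positivity
  have hτ' : (0 : ℝ) < τ := by positivity
  have hp := (gaussianPDFReal_pos μ τ y hτ).ne'
  have e : gaussianPDFReal μ τ x * (gaussianPDFReal μ τ y *
        (gaussianPDFReal (μ + ρ * (x - μ)) v y / gaussianPDFReal μ τ y) ^ 2) =
      gaussianPDFReal μ τ x * gaussianPDFReal (μ + ρ * (x - μ)) v y ^ 2
        / gaussianPDFReal μ τ y := by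
    field_simp
  rw [e]
  simp only [gaussianPDFReal, hv, hw₁, hw₂]
  have hs : √(2 * Real.pi * (τ * (1 + ρ ^ 2) / (1 - ρ ^ 2))) *
      √(2 * Real.pi * (τ * (1 - ρ ^ 2) / (1 + ρ ^ 2))) = 2 * Real.pi * τ := by
    rw [← Real.sqrt_mul (by positivity), Real.sqrt_eq_iff_mul_self_eq (by positivity)
      (by positivity)]
    field_simp
  have hs' : √(2 * Real.pi * ((1 - ρ ^ 2) * τ)) ^ 2 = 2 * Real.pi * ((1 - ρ ^ 2) * τ) :=
    Real.sq_sqrt (by positivity)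
  have hst : √(2 * Real.pi * τ) ≠ 0 := by positivity
  calc _ = (√(2 * Real.pi * ((1 - ρ ^ 2) * τ)) ^ 2)⁻¹ *
        (Real.exp (-(x - μ) ^ 2 / (2 * τ)) *
          Real.exp (-(y - (μ + ρ * (x - μ))) ^ 2 / (2 * ((1 - ρ ^ 2) * τ))) ^ 2
          / Real.exp (-(y - μ) ^ 2 / (2 * τ))) := by
        field_simp
    _ = (1 / (1 - ρ ^ 2)) * (2 * Real.pi * τ)⁻¹ *
        (Real.exp (-(x - μ) ^ 2 / (2 * (τ * (1 + ρ ^ 2) / (1 - ρ ^ 2)))) *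
        Real.exp (-(y - (μ + 2 * ρ * (x - μ) / (1 + ρ ^ 2))) ^ 2 /
          (2 * (τ * (1 - ρ ^ 2) / (1 + ρ ^ 2))))) := by
        rw [hs', ← Real.exp_nat_mul, ← Real.exp_add, ← Real.exp_sub, ← Real.exp_add]
        congr 1
        · field_simp
        · congr 1
          field_simp
          push_cast
          ring
    _ = _ := by
        rw [← hs, mul_inv]
        ring

theorem lintegral_gaussianReal_eq {μ : ℝ} {τ : ℝ≥0} (hτ : τ ≠ 0) {f : ℝ → ℝ≥0∞}
    (hf : Measurable f) :
    ∫⁻ y, f y ∂gaussianReal μ τ = ∫⁻ y, ENNReal.ofReal (gaussianPDFReal μ τ y) * f y := by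
  rw [gaussianReal_of_var_ne_zero _ hτ, lintegral_withDensity_eq_lintegral_mul _
    (measurable_gaussianPDF _ _) hf]
  rfl

theorem measurable_gaussianPDFReal_comp {α : Type*} [MeasurableSpace α] {m y : α → ℝ}
    (hm : Measurable m) (hy : Measurable y) (v : ℝ≥0) :
    Measurable fun z => gaussianPDFReal (m z) v (y z) := by
  unfold gaussianPDFReal
  fun_prop

/-- The density of the transition law of a Gaussian autoregression with respect to its
stationary law. -/
def mehlerDensity (μ ρ : ℝ) (τ v : ℝ≥0) (z : ℝ × ℝ) : ℝ :=
  gaussianPDFReal (μ + ρ * (z.1 - μ)) v z.2 / gaussianPDFReal μ τ z.2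

theorem measurable_mehlerDensity (μ ρ : ℝ) (τ v : ℝ≥0) : Measurable (mehlerDensity μ ρ τ v) :=
  (measurable_gaussianPDFReal_comp (by fun_prop) (by fun_prop) v).div
    (measurable_gaussianPDFReal_comp (by fun_prop) (by fun_prop) τ)

theorem mehlerDensity_nonneg (μ ρ : ℝ) (τ v : ℝ≥0) (z : ℝ × ℝ) : 0 ≤ mehlerDensity μ ρ τ v z :=
  div_nonneg (gaussianPDFReal_nonneg _ _ _) (gaussianPDFReal_nonneg _ _ _)

theorem gaussianReal_eq_withDensity_mehlerDensity (μ ρ : ℝ) {τ v : ℝ≥0} (hτ : τ ≠ 0) (hv : v ≠ 0)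
    (x : ℝ) : gaussianReal (μ + ρ * (x - μ)) v =
      (gaussianReal μ τ).withDensity fun y => ENNReal.ofReal (mehlerDensity μ ρ τ v (x, y)) := by
  have hm : Measurable fun y => ENNReal.ofReal (mehlerDensity μ ρ τ v (x, y)) :=
    ((measurable_mehlerDensity μ ρ τ v).comp measurable_prodMk_left).ennreal_ofReal
  rw [gaussianReal_of_var_ne_zero _ hτ, gaussianReal_of_var_ne_zero _ hv,
    ← withDensity_mul _ (measurable_gaussianPDF _ _) hm]
  congr 1
  ext y
  simp only [Pi.mul_apply, gaussianPDF, mehlerDensity]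
  rw [← ENNReal.ofReal_mul (gaussianPDFReal_nonneg _ _ _),
    mul_div_cancel₀ _ (gaussianPDFReal_pos μ τ y hτ).ne']

theorem lintegral_mehlerDensity (μ ρ : ℝ) {τ v : ℝ≥0} (hτ : τ ≠ 0) (hv : v ≠ 0) :
    ∫⁻ z, ENNReal.ofReal (mehlerDensity μ ρ τ v z)
      ∂(gaussianReal μ τ).prod (gaussianReal μ τ) = 1 := by
  rw [lintegral_prod _ (measurable_mehlerDensity μ ρ τ v).ennreal_ofReal.aemeasurable]
  have : ∀ x, ∫⁻ y, ENNReal.ofReal (mehlerDensity μ ρ τ v (x, y)) ∂gaussianReal μ τ = 1 := by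
    intro x
    rw [← setLIntegral_univ, ← withDensity_apply _ MeasurableSet.univ,
      ← gaussianReal_eq_withDensity_mehlerDensity μ ρ hτ hv x, measure_univ]
  simp [this]

theorem lintegral_mehlerDensity_sq (μ : ℝ) {ρ : ℝ} (hρ : |ρ| < 1) {τ v : ℝ≥0} (hτ : τ ≠ 0)
    (hv : (v : ℝ) = (1 - ρ ^ 2) * τ) :
    ∫⁻ z, ENNReal.ofReal (mehlerDensity μ ρ τ v z ^ 2)
      ∂(gaussianReal μ τ).prod (gaussianReal μ τ) = ENNReal.ofReal (1 / (1 - ρ ^ 2)) := by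
  have h1 : 0 < 1 - ρ ^ 2 := by
    have := (sq_lt_one_iff_abs_lt_one ρ).2 hρ
    linarith
  have h2 : 0 < 1 + ρ ^ 2 := by positivity
  have hτ' : (0 : ℝ) < τ := by positivity
  obtain ⟨w₁, hw₁⟩ : ∃ w : ℝ≥0, (w : ℝ) = τ * (1 - ρ ^ 2) / (1 + ρ ^ 2) :=
    ⟨⟨_, by positivity⟩, rfl⟩
  obtain ⟨w₂, hw₂⟩ : ∃ w : ℝ≥0, (w : ℝ) = τ * (1 + ρ ^ 2) / (1 - ρ ^ 2) :=
    ⟨⟨_, by positivity⟩, rfl⟩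
  have hw₁0 : w₁ ≠ 0 := by
    rw [← NNReal.coe_ne_zero, hw₁]; positivity
  have hw₂0 : w₂ ≠ 0 := by
    rw [← NNReal.coe_ne_zero, hw₂]; positivity
  have hm := measurable_mehlerDensity μ ρ τ v
  rw [lintegral_prod _ (hm.pow_const 2).ennreal_ofReal.aemeasurable]
  have key : ∀ x, ENNReal.ofReal (gaussianPDFReal μ τ x) *
      ∫⁻ y, ENNReal.ofReal (mehlerDensity μ ρ τ v (x, y) ^ 2) ∂gaussianReal μ τ =
      ENNReal.ofReal (1 / (1 - ρ ^ 2)) * ENNReal.ofReal (gaussianPDFReal μ w₂ x) := by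
    intro x
    have hmx : Measurable fun y => mehlerDensity μ ρ τ v (x, y) ^ 2 :=
      (hm.comp measurable_prodMk_left).pow_const 2
    have hmp : Measurable fun y => ENNReal.ofReal (gaussianPDFReal μ τ y) *
        ENNReal.ofReal (mehlerDensity μ ρ τ v (x, y) ^ 2) :=
      (measurable_gaussianPDFReal _ _).ennreal_ofReal.mul hmx.ennreal_ofReal
    rw [lintegral_gaussianReal_eq hτ hmx.ennreal_ofReal, ← lintegral_const_mul _ hmp]
    have : ∀ y, ENNReal.ofReal (gaussianPDFReal μ τ x) *
        (ENNReal.ofReal (gaussianPDFReal μ τ y) *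
          ENNReal.ofReal (mehlerDensity μ ρ τ v (x, y) ^ 2)) =
        ENNReal.ofReal (1 / (1 - ρ ^ 2) * gaussianPDFReal μ w₂ x) * ENNReal.ofReal
          (gaussianPDFReal (μ + 2 * ρ * (x - μ) / (1 + ρ ^ 2)) w₁ y) := by
      intro y
      rw [← ENNReal.ofReal_mul (gaussianPDFReal_nonneg _ _ _),
        ← ENNReal.ofReal_mul (gaussianPDFReal_nonneg _ _ _), mehlerDensity,
        gaussianPDFReal_sq_div_mul hρ hτ hv hw₁ hw₂, ← ENNReal.ofReal_mul
          (mul_nonneg (by positivity) (gaussianPDFReal_nonneg _ _ _)), ← mul_assoc (1 / (1 - ρ ^ 2))]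
    simp_rw [this]
    rw [lintegral_const_mul _ (measurable_gaussianPDFReal _ _).ennreal_ofReal,
      lintegral_gaussianPDFReal_eq_one _ hw₁0, mul_one, ENNReal.ofReal_mul (by positivity)]
  have hmi : Measurable fun x =>
      ∫⁻ y, ENNReal.ofReal (mehlerDensity μ ρ τ v (x, y) ^ 2) ∂gaussianReal μ τ :=
    (hm.pow_const 2).ennreal_ofReal.lintegral_prod_right'
  rw [lintegral_gaussianReal_eq hτ hmi]
  simp_rw [key]
  rw [lintegral_const_mul _ (measurable_gaussianPDFReal _ _).ennreal_ofReal,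
    lintegral_gaussianPDFReal_eq_one _ hw₂0, mul_one]

/-- Cauchy–Schwarz, in the form that the variance of `|r - 1|` is nonnegative, with `E (r - 1)² = 1
/ (1 - ρ²) - 1`. -/
theorem integral_abs_mehlerDensity_sub_one_le (μ : ℝ) {ρ : ℝ} (hρ : |ρ| < 1) {τ v : ℝ≥0}
    (hτ : τ ≠ 0) (hv : (v : ℝ) = (1 - ρ ^ 2) * τ) :
    Integrable (mehlerDensity μ ρ τ v) ((gaussianReal μ τ).prod (gaussianReal μ τ)) ∧
    ∫ z, |mehlerDensity μ ρ τ v z - 1| ∂(gaussianReal μ τ).prod (gaussianReal μ τ) ≤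
      |ρ| / √(1 - ρ ^ 2) := by
  have h1 : 0 < 1 - ρ ^ 2 := by
    have := (sq_lt_one_iff_abs_lt_one ρ).2 hρ
    linarith
  have hv0 : v ≠ 0 := by
    rw [← NNReal.coe_ne_zero, hv]
    have : (0 : ℝ) < τ := by positivity
    positivity
  set M := (gaussianReal μ τ).prod (gaussianReal μ τ)
  set r := mehlerDensity μ ρ τ v
  have hm : Measurable r := measurable_mehlerDensity μ ρ τ v
  have h0 : ∀ z, 0 ≤ r z := mehlerDensity_nonneg μ ρ τ v
  have hl1 : ∫⁻ z, ENNReal.ofReal (r z) ∂M = 1 := lintegral_mehlerDensity μ ρ hτ hv0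
  have hl2 : ∫⁻ z, ENNReal.ofReal (r z ^ 2) ∂M = ENNReal.ofReal (1 / (1 - ρ ^ 2)) :=
    lintegral_mehlerDensity_sq μ hρ hτ hv
  have hi1 : Integrable r M := by
    refine ⟨hm.aestronglyMeasurable, ?_⟩
    rw [hasFiniteIntegral_iff_ofReal (ae_of_all _ h0), hl1]
    exact ENNReal.one_lt_top
  have hi2 : Integrable (fun z => r z ^ 2) M := by
    refine ⟨(hm.pow_const 2).aestronglyMeasurable, ?_⟩
    rw [hasFiniteIntegral_iff_ofReal (ae_of_all _ fun _ => sq_nonneg _), hl2]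
    exact ENNReal.ofReal_lt_top
  have e1 : ∫ z, r z ∂M = 1 := by
    rw [integral_eq_lintegral_of_nonneg_ae (ae_of_all _ h0) hm.aestronglyMeasurable, hl1]
    simp
  have e2 : ∫ z, r z ^ 2 ∂M = 1 / (1 - ρ ^ 2) := by
    rw [integral_eq_lintegral_of_nonneg_ae (ae_of_all _ fun _ => sq_nonneg _)
      (hm.pow_const 2).aestronglyMeasurable, hl2, ENNReal.toReal_ofReal (by positivity)]
  have e3 : ∫ z, |r z - 1| ^ 2 ∂M = ρ ^ 2 / (1 - ρ ^ 2) := by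
    have : ∀ z, |r z - 1| ^ 2 = r z ^ 2 - (2 * r z - 1) := fun z => by rw [sq_abs]; ring
    simp_rw [this]
    have hi3 : Integrable (fun z => 2 * r z - 1) M := (hi1.const_mul 2).sub (integrable_const 1)
    rw [integral_sub hi2 hi3,
      integral_sub (hi1.const_mul 2) (integrable_const 1), integral_const_mul, e1, e2]
    simp only [integral_const, probReal_univ, smul_eq_mul]
    field_simp
    ring
  have hL2 : MemLp (fun z => |r z - 1|) 2 M := by
    have : MemLp r 2 M := (memLp_two_iff_integrable_sq hm.aestronglyMeasurable).2 hi2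
    exact (this.sub (memLp_const 1)).abs
  have hvar := variance_nonneg (fun z => |r z - 1|) M
  rw [variance_eq_sub hL2] at hvar
  refine ⟨hi1, ?_⟩
  have e4 : |ρ| / √(1 - ρ ^ 2) = √(ρ ^ 2 / (1 - ρ ^ 2)) := by
    rw [Real.sqrt_div (sq_nonneg _), Real.sqrt_sq_eq_abs]
  rw [e4, ← e3]
  refine Real.le_sqrt_of_sq_le ?_
  simpa using hvar

/-- The total variation distance between the transition law `N(μ + ρ (x - μ), (1 - ρ²) τ)` and the
stationary law `N(μ, τ)`, both times a common second factor, is on average at most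
`|ρ| / (2 √(1 - ρ²))`. -/
theorem exists_gaussian_tv_bound (μ : ℝ) {ρ : ℝ} (hρ : |ρ| < 1) {τ v : ℝ≥0}
    (hv : (v : ℝ) = (1 - ρ ^ 2) * τ) {β : Type*} [MeasurableSpace β] (η : Measure β)
    [IsProbabilityMeasure η] :
    ∃ D : ℝ → ℝ, Measurable D ∧
      ∫⁻ x, ENNReal.ofReal (D x) ∂gaussianReal μ τ ≤ ENNReal.ofReal (|ρ| / (2 * √(1 - ρ ^ 2))) ∧
      ∀ᵐ x ∂gaussianReal μ τ, ∀ C : Set (ℝ × β), MeasurableSet C →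
        |((gaussianReal (μ + ρ * (x - μ)) v).prod η).real C -
          ((gaussianReal μ τ).prod η).real C| ≤ D x := by
  have h1 : 0 < 1 - ρ ^ 2 := by
    have := (sq_lt_one_iff_abs_lt_one ρ).2 hρ
    linarith
  -- Without noise there is no density, but the stationary law is the Dirac mass at `μ`, and from `x
  -- = μ` the transition law is the same Dirac mass.
  by_cases hτ : τ = 0
  · subst hτ
    have hv0 : v = 0 := by
      rw [← NNReal.coe_eq_zero, hv]; simp
    subst hv0
    refine ⟨fun _ => 0, measurable_const, by simp, ?_⟩
    rw [gaussianReal_zero_var, ae_dirac_eq]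
    simp
  · have hv0 : v ≠ 0 := by
      rw [← NNReal.coe_ne_zero, hv]
      have : (0 : ℝ) < τ := by positivity
      positivity
    obtain ⟨hi, hle⟩ := integral_abs_mehlerDensity_sub_one_le μ hρ hτ hv
    have hi' : Integrable (fun z => |mehlerDensity μ ρ τ v z - 1|)
        ((gaussianReal μ τ).prod (gaussianReal μ τ)) := (hi.sub (integrable_const 1)).abs
    have hm := measurable_mehlerDensity μ ρ τ v
    refine ⟨fun x => (∫ y, |mehlerDensity μ ρ τ v (x, y) - 1| ∂gaussianReal μ τ) / 2,
      ?_, ?_, ae_of_all _ fun x C hC => ?_⟩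
    · have : StronglyMeasurable fun z => |mehlerDensity μ ρ τ v z - 1| := by
        have : Measurable fun z => |mehlerDensity μ ρ τ v z - 1| := by fun_prop
        exact this.stronglyMeasurable
      exact this.integral_prod_right'.measurable.div_const 2
    · have hii := hi'.integral_prod_left
      rw [← ofReal_integral_eq_lintegral_ofReal (hii.div_const 2)
        (ae_of_all _ fun x => div_nonneg (integral_nonneg fun _ => abs_nonneg _) zero_le_two)]
      refine ENNReal.ofReal_le_ofReal ?_
      rw [integral_div, ← integral_prod _ hi']
      calc _ ≤ |ρ| / √(1 - ρ ^ 2) / 2 := by gcongr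
        _ = _ := by rw [div_div, mul_comm]
    · exact abs_prod_sub_prod_le _ η (hm.comp measurable_prodMk_left)
        (fun y => mehlerDensity_nonneg μ ρ τ v (x, y))
        (gaussianReal_eq_withDensity_mehlerDensity μ ρ hτ hv0 x) hC

/-! ### Conditional laws and independence -/

/-- The conditional law of `f (X, W)` given `X`, for `W` independent of `X`. -/
theorem condDistrib_comp_prodMk_of_indepFun {Ω α β γ : Type*} [MeasurableSpace Ω]
    [MeasurableSpace α] [MeasurableSpace β] [MeasurableSpace γ] [StandardBorelSpace γ] [Nonempty γ]
    {P : Measure Ω} [IsProbabilityMeasure P] {X : Ω → α} {W : Ω → β} (hX : Measurable X)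
    (hW : Measurable W) (h : IndepFun X W P) {f : α × β → γ} (hf : Measurable f) :
    ∀ᵐ a ∂P.map X, condDistrib (fun ω => f (X ω, W ω)) X P a = (P.map W).map fun w => f (a, w) := by
  have := Measure.isProbabilityMeasure_map (μ := P) hW.aemeasurable
  have := Measure.isProbabilityMeasure_map (μ := P) hX.aemeasurable
  have key := condDistrib_ae_eq_of_measure_eq_compProd_of_measurable (μ := P) hX
    (hf.comp (hX.prodMk hW)) (κ := (Kernel.id ×ₖ Kernel.const α (P.map W)).map f) ?_
  · filter_upwards [key] with a ha
    refine Eq.trans ha ?_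
    rw [Kernel.map_apply _ hf, Kernel.prod_apply, Kernel.id_apply, Kernel.const_apply,
      Measure.dirac_prod, Measure.map_map hf measurable_prodMk_left]
    rfl
  · have hg : Measurable fun z : α × β => (z.1, f z) := measurable_fst.prodMk hf
    have e : P.map (fun ω => (X ω, (f ∘ fun ω => (X ω, W ω)) ω)) =
        ((P.map X).prod (P.map W)).map fun z => (z.1, f z) := by
      rw [← (indepFun_iff_map_prod_eq_prod_map_map hX.aemeasurable hW.aemeasurable).1 h,
        Measure.map_map hg (hX.prodMk hW)]
      rfl
    rw [e]
    ext s hs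
    rw [Measure.map_apply hg hs, Measure.prod_apply (hg hs), Measure.compProd_apply hs]
    refine lintegral_congr fun a => ?_
    rw [Kernel.map_apply _ hf, Kernel.prod_apply, Kernel.id_apply, Kernel.const_apply,
      Measure.dirac_prod, Measure.map_map hf measurable_prodMk_left,
      Measure.map_apply (hf.comp measurable_prodMk_left) (measurable_prodMk_left hs)]
    rfl

theorem comap_pi_restrict {ι Ω β : Type*} [MeasurableSpace β] (f : ι → Ω → β) (S : Set ι) :
    MeasurableSpace.comap (fun ω (i : S) => f i ω) inferInstance =
      ⨆ i ∈ S, MeasurableSpace.comap (f i) inferInstance := by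
  simp only [MeasurableSpace.pi, MeasurableSpace.comap_iSup, MeasurableSpace.comap_comp]
  rw [iSup_subtype']
  rfl

theorem iIndepFun.indepFun_restrict_of_disjoint {ι Ω β : Type*} [MeasurableSpace Ω]
    [MeasurableSpace β] {P : Measure Ω} {f : ι → Ω → β} (hf : ∀ i, Measurable (f i))
    (h : iIndepFun f P) {S T : Set ι} (hST : Disjoint S T) :
    IndepFun (fun ω (i : S) => f i ω) (fun ω (i : T) => f i ω) P := by
  rw [IndepFun_iff_Indep, comap_pi_restrict, comap_pi_restrict]
  exact indep_iSup_of_disjoint (fun i => (hf i).comap_le) h hST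

theorem tendsto_measure_le_abs_pow_mul {Ω : Type*} [MeasurableSpace Ω] (P : Measure Ω)
    [IsProbabilityMeasure P] {θ : ℝ} (hθ : |θ| < 1) {Y : Ω → ℝ} (hY : Measurable Y) {δ : ℝ}
    (hδ : 0 < δ) : Tendsto (fun n : ℕ => P {ω | δ ≤ |θ ^ n * Y ω|}) atTop (𝓝 0) := by
  have h : TendstoInMeasure P (fun (n : ℕ) ω => θ ^ n * Y ω) atTop fun _ => 0 := by
    refine tendstoInMeasure_of_tendsto_ae
      (fun n => (hY.const_mul _).aestronglyMeasurable) (ae_of_all _ fun ω => ?_)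
    simpa using (tendsto_pow_atTop_nhds_zero_of_abs_lt_one hθ).mul_const (Y ω)
  simpa [Real.norm_eq_abs, abs_mul] using (tendstoInMeasure_iff_norm.1 h) δ hδ

/-! ### The autoregression: causal solution, uniqueness, causality -/

variable {Ω : Type*} [MeasurableSpace Ω] {P : Measure Ω}
  {ψ θ : ℝ} {ε x x' : ℤ → Ω → ℝ}

/-- The autoregressive recursion started at `y` and driven by the innovations `e`. -/
def arPath (ψ θ y : ℝ) (e : ℕ → ℝ) : ℕ → ℝ
  | 0 => y
  | n + 1 => ψ + θ * arPath ψ θ y e n + e n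

/-- The innovations after time `t`. -/
def innovations (ε : ℤ → Ω → ℝ) (t : ℤ) (ω : Ω) (n : ℕ) : ℝ := ε (t + 1 + n) ω

theorem measurable_innovations (hε : ∀ t, Measurable (ε t)) (t : ℤ) :
    Measurable (innovations ε t) :=
  measurable_pi_lambda _ fun _ => hε _

/-- The recursion is affine in its starting point, so the memory of `y` separates from the
contribution of the innovations. -/
theorem arPath_eq (ψ θ y : ℝ) (e : ℕ → ℝ) (n : ℕ) :
    arPath ψ θ y e n = θ ^ n * y + arPath ψ θ 0 e n := by
  induction n with
  | zero => simp [arPath]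
  | succ n ih => rw [arPath, arPath, ih]; ring

theorem measurable_arPath (ψ θ : ℝ) (n : ℕ) :
    Measurable fun z : ℝ × (ℕ → ℝ) => arPath ψ θ z.1 z.2 n := by
  induction n with
  | zero => exact measurable_fst
  | succ n ih =>
    have h : Measurable fun z : ℝ × (ℕ → ℝ) => z.2 n := (measurable_pi_apply n).comp measurable_snd
    exact ((ih.const_mul θ).const_add ψ).add h

theorem measurable_past (hx : ∀ t, Measurable (x t)) (t : ℤ) : Measurable (past x t) :=
  measurable_pi_lambda _ fun _ => hx _

theorem measurable_future (hx : ∀ t, Measurable (x t)) (t : ℤ) : Measurable (future x t) :=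
  measurable_pi_lambda _ fun _ => hx _

theorem ae_eq_arPath (hx : ∀ t, ∀ᵐ ω ∂P, x t ω = ψ + θ * x (t - 1) ω + ε t ω) :
    ∀ᵐ ω ∂P, ∀ (t : ℤ) (n : ℕ), x (t + n) ω = arPath ψ θ (x t ω) (innovations ε t ω) n := by
  filter_upwards [ae_all_iff.2 hx] with ω hω t n
  induction n with
  | zero => simp [arPath]
  | succ n ih =>
    rw [arPath, ← ih, hω]
    simp only [innovations]
    push_cast
    rw [show t + ((n : ℤ) + 1) - 1 = t + n by ring, show t + ((n : ℤ) + 1) = t + 1 + n by ring]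

/-- The stationary solution as a function of the innovations, the most recent one first. -/
def arSeries (ψ θ : ℝ) (e : ℕ → ℝ) : ℝ := ψ / (1 - θ) + ∑' j, θ ^ j * e j

theorem measurable_arSeries (ψ θ : ℝ) : Measurable (arSeries ψ θ) := by
  refine Measurable.const_add (Measurable.tsum fun j => ?_) _
  exact (measurable_pi_apply j).const_mul _

theorem arSeries_cons (ψ : ℝ) (hθ : |θ| < 1) {e : ℕ → ℝ}
    (he : Summable fun j => θ ^ j * e (j + 1)) :
    arSeries ψ θ e = ψ + θ * arSeries ψ θ (fun j => e (j + 1)) + e 0 := by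
  have h1 : 1 - θ ≠ 0 := by
    have := (abs_lt.1 hθ).2
    linarith
  have h : ∀ j, θ ^ (j + 1) * e (j + 1) = θ * (θ ^ j * e (j + 1)) := fun j => by ring
  have hs : Summable fun j => θ ^ j * e j := by
    rw [← summable_nat_add_iff 1]
    simp_rw [h]
    exact he.mul_left θ
  rw [arSeries, arSeries, hs.tsum_eq_zero_add]
  simp_rw [h]
  rw [tsum_mul_left]
  field_simp
  ring

/-- The expected sum of absolute values is a geometric series times the first absolute moment; no
independence enters. -/
theorem ae_summable_pow_mul {ν : Measure ℝ} [IsProbabilityMeasure ν] (hν : Integrable id ν)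
    (hθ : |θ| < 1) {e : ℕ → Ω → ℝ} (he : ∀ j, HasLaw (e j) ν P) :
    ∀ᵐ ω ∂P, Summable fun j => θ ^ j * e j ω := by
  have hfin : ∑' j, ∫⁻ ω, ‖θ ^ j * e j ω‖ₑ ∂P ≠ ∞ := by
    have h : ∀ j, ∫⁻ ω, ‖θ ^ j * e j ω‖ₑ ∂P = ‖θ‖ₑ ^ j * ∫⁻ y, ‖y‖ₑ ∂ν := by
      intro j
      rw [← (he j).lintegral_comp (f := fun y => ‖y‖ₑ) (by fun_prop), ← lintegral_const_mul']
      · simp [enorm_mul]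
      · simp
    simp_rw [h]
    rw [ENNReal.tsum_mul_right, ENNReal.tsum_geometric]
    refine ENNReal.mul_ne_top (ENNReal.inv_ne_top.2 ?_) hν.2.ne
    rw [ne_eq, tsub_eq_zero_iff_le, not_le, Real.enorm_eq_ofReal_abs, ← ENNReal.ofReal_one]
    exact (ENNReal.ofReal_lt_ofReal_iff one_pos).2 hθ
  have hm : ∀ j, AEMeasurable (fun ω => ‖θ ^ j * e j ω‖ₑ) P := fun j =>
    ((he j).aemeasurable.const_mul _).enorm
  rw [← lintegral_tsum hm] at hfin
  filter_upwards [ae_lt_top' (AEMeasurable.tsum hm) hfin] with ω hω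
  exact Summable.of_enorm hω.ne

theorem map_shift_eq {ν : Measure ℝ} [IsProbabilityMeasure ν] (hε : ∀ t, Measurable (ε t))
    (hi : iIndepFun ε P) (hl : ∀ t, HasLaw (ε t) ν P) (h : ℤ) :
    P.map (fun ω (t : ℤ) => ε (t + h) ω) = P.map fun ω t => ε t ω := by
  rw [hi.map_fun_eq_infinitePi_map hε,
    (hi.precomp (add_left_injective h)).map_fun_eq_infinitePi_map fun t => hε (t + h)]
  congr 1
  funext t
  exact (hl _).map_eq.trans (hl _).map_eq.symm

/-- The causal stationary solution. -/
def arSolution (ψ θ : ℝ) (ε : ℤ → Ω → ℝ) (t : ℤ) (ω : Ω) : ℝ :=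
  arSeries ψ θ fun j => ε (t - j) ω

theorem isStationaryAR1_arSolution {ν : Measure ℝ} [IsProbabilityMeasure ν] (hν : Integrable id ν)
    (hθ : |θ| < 1) (hε : ∀ t, Measurable (ε t)) (hi : iIndepFun ε P)
    (hl : ∀ t, HasLaw (ε t) ν P) : IsStationaryAR1 P ψ θ ε (arSolution ψ θ ε) where
  measurable t := (measurable_arSeries ψ θ).comp (measurable_pi_lambda _ fun _ => hε _)
  -- The whole solution is one measurable function of the innovation path that commutes with shifts,
  -- so it inherits the shift invariance of the i.i.d. law.
  stationary h := by
    have hm : Measurable fun (e : ℤ → ℝ) (t : ℤ) => arSeries ψ θ fun j : ℕ => e (t - j) :=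
      measurable_pi_lambda _ fun t => (measurable_arSeries ψ θ).comp
        (measurable_pi_lambda _ fun j => measurable_pi_apply _)
    have e1 := congrArg (Measure.map fun (e : ℤ → ℝ) (t : ℤ) => arSeries ψ θ fun j : ℕ => e (t - j))
      (map_shift_eq hε hi hl h)
    rw [Measure.map_map hm (measurable_pi_lambda _ fun _ => hε _),
      Measure.map_map hm (measurable_pi_lambda _ fun _ => hε _)] at e1
    have e2 : (fun ω t => arSolution ψ θ ε (t + h) ω) =
        (fun (e : ℤ → ℝ) (t : ℤ) => arSeries ψ θ fun j : ℕ => e (t - j)) ∘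
          fun ω t => ε (t + h) ω := by
      funext ω t
      simp only [arSolution, Function.comp_apply]
      congr 1
      funext j
      rw [sub_add_eq_add_sub]
    rw [e2, e1]
    rfl
  recursion t := by
    filter_upwards [ae_summable_pow_mul hν hθ fun j : ℕ => hl (t - 1 - j)] with ω hω
    have e : ∀ j : ℕ, t - ((j + 1 : ℕ) : ℤ) = t - 1 - j := fun j => by push_cast; ring
    have := arSeries_cons ψ hθ (e := fun j : ℕ => ε (t - j) ω) (by simpa only [e] using hω)
    simp only [e] at this
    simpa [arSolution] using this

theorem IsStationary.map_eq (hx : ∀ t, Measurable (x t)) (h : IsStationary P x) (s t : ℤ) :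
    P.map (x s) = P.map (x t) := by
  have e := congrArg (Measure.map fun y : ℤ → ℝ => y t) (h (s - t))
  rw [Measure.map_map (measurable_pi_apply t) (measurable_pi_lambda _ fun _ => hx _),
    Measure.map_map (measurable_pi_apply t) (measurable_pi_lambda _ fun _ => hx _)] at e
  simpa [Function.comp_def] using e

/-- The difference at `t` is `θ ^ n` times the difference at `t - n`. The two terms are bounded
separately, so stationarity of each solution suffices and joint stationarity is not needed: `θ ^ n *
x (t - n)` has the law of `θ ^ n * x t`, which tends to zero in probability. -/
theorem IsStationaryAR1.ae_eq [IsProbabilityMeasure P] (hθ : |θ| < 1) (hx : IsStationaryAR1 P ψ θ ε x)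
    (hx' : IsStationaryAR1 P ψ θ ε x') (t : ℤ) : x t =ᵐ[P] x' t := by
  have hlaw : ∀ {y : ℤ → Ω → ℝ}, IsStationaryAR1 P ψ θ ε y → ∀ (n : ℕ) (δ : ℝ),
      P {ω | δ ≤ |θ ^ n * y (t - n) ω|} = P {ω | δ ≤ |θ ^ n * y t ω|} := by
    intro y hy n δ
    have hs : MeasurableSet {a : ℝ | δ ≤ |θ ^ n * a|} :=
      measurableSet_le measurable_const (by fun_prop)
    have := congrArg (fun m => m {a : ℝ | δ ≤ |θ ^ n * a|})
      (hy.stationary.map_eq hy.measurable (t - n) t)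
    simp only [Measure.map_apply (hy.measurable _) hs] at this
    exact this
  have hd : ∀ᵐ ω ∂P, ∀ n : ℕ, x t ω - x' t ω = θ ^ n * x (t - n) ω - θ ^ n * x' (t - n) ω := by
    filter_upwards [ae_eq_arPath hx.recursion, ae_eq_arPath hx'.recursion] with ω h h' n
    have h1 := h (t - n) n
    have h2 := h' (t - n) n
    rw [arPath_eq, sub_add_cancel] at h1 h2
    rw [h1, h2]
    ring
  have hzero : ∀ δ : ℝ, 0 < δ → P {ω | δ ≤ |x t ω - x' t ω|} = 0 := by
    intro δ hδ
    have hlim := (tendsto_measure_le_abs_pow_mul P hθ (hx.measurable t) (half_pos hδ)).add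
      (tendsto_measure_le_abs_pow_mul P hθ (hx'.measurable t) (half_pos hδ))
    rw [add_zero] at hlim
    refine le_antisymm (ge_of_tendsto' hlim fun n => ?_) zero_le
    rw [← hlaw hx, ← hlaw hx']
    refine (measure_mono_ae ?_).trans (measure_union_le _ _)
    filter_upwards [hd] with ω hω hle
    have hle' : δ ≤ |x t ω - x' t ω| := hle
    rw [hω n] at hle'
    by_contra hcon
    have hc : ¬ (δ / 2 ≤ |θ ^ n * x (t - n) ω| ∨ δ / 2 ≤ |θ ^ n * x' (t - n) ω|) := hcon
    push Not at hc
    linarith [abs_sub (θ ^ n * x (t - n) ω) (θ ^ n * x' (t - n) ω)]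
  have hall : ∀ᵐ ω ∂P, ∀ n : ℕ, ¬ (1 / ((n : ℝ) + 1) ≤ |x t ω - x' t ω|) := by
    rw [ae_all_iff]
    intro n
    rw [ae_iff]
    simpa using hzero (1 / ((n : ℝ) + 1)) (by positivity)
  filter_upwards [hall] with ω hω
  by_contra hne
  obtain ⟨n, hn⟩ := exists_nat_one_div_lt (abs_pos.2 (sub_ne_zero.2 hne))
  exact hω n hn.le

theorem indepFun_past_innovations_arSolution (hε : ∀ t, Measurable (ε t)) (hi : iIndepFun ε P)
    (t : ℤ) : IndepFun (past (arSolution ψ θ ε) t) (innovations ε t) P := by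
  have h := iIndepFun.indepFun_restrict_of_disjoint hε hi
    (S := Set.Iic t) (T := Set.Ioi t) (Set.Iic_disjoint_Ioi le_rfl)
  have h1 : Measurable fun (e : Set.Iic t → ℝ) (s : Set.Iic t) =>
      arSeries ψ θ fun j : ℕ => e ⟨s - j, (sub_le_self _ (Int.natCast_nonneg j)).trans s.2⟩ :=
    measurable_pi_lambda _ fun s => (measurable_arSeries ψ θ).comp
      (measurable_pi_lambda _ fun j => measurable_pi_apply _)
  have h2 : Measurable fun (e : Set.Ioi t → ℝ) (n : ℕ) =>
      e ⟨t + 1 + n, Set.mem_Ioi.2 (by omega)⟩ :=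
    measurable_pi_lambda _ fun n => measurable_pi_apply _
  exact h.comp h1 h2

/-- By uniqueness the past agrees almost surely with that of the causal series, for all the
countably many times at once, and independence ignores null sets. -/
theorem IsStationaryAR1.indepFun_past_innovations [IsProbabilityMeasure P] {ν : Measure ℝ}
    [IsProbabilityMeasure ν] (hν : Integrable id ν) (hθ : |θ| < 1) (hε : ∀ t, Measurable (ε t)) (hi : iIndepFun ε P)
    (hl : ∀ t, HasLaw (ε t) ν P) (hx : IsStationaryAR1 P ψ θ ε x) (t : ℤ) :
    IndepFun (past x t) (innovations ε t) P := by
  refine (indepFun_past_innovations_arSolution (ψ := ψ) (θ := θ) hε hi t).congr ?_ EventuallyEq.rfl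
  have := ae_all_iff.2 ((isStationaryAR1_arSolution (ψ := ψ) hν hθ hε hi hl).ae_eq hθ hx)
  filter_upwards [this] with ω hω
  funext s
  exact hω s

/-! ### Gaussian laws and the mixing bound -/

variable {σsq : ℝ≥0}

/-- The path after time `u` of the autoregression, from its value at `u` and later innovations. -/
def arFuture (ψ θ : ℝ) (u : ℤ) (z : ℝ × (ℕ → ℝ)) (s : Set.Ici u) : ℝ :=
  arPath ψ θ z.1 z.2 ((s : ℤ) - u).toNat

theorem measurable_arFuture (ψ θ : ℝ) (u : ℤ) : Measurable (arFuture ψ θ u) :=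
  measurable_pi_lambda _ fun _ => measurable_arPath ψ θ _

theorem future_ae_eq_arFuture (hx : IsStationaryAR1 P ψ θ ε x) (u : ℤ) :
    future x u =ᵐ[P] fun ω => arFuture ψ θ u (x u ω, innovations ε u ω) := by
  filter_upwards [ae_eq_arPath hx.recursion] with ω hω
  funext s
  have := hω u ((s : ℤ) - u).toNat
  rw [Int.toNat_of_nonneg (sub_nonneg.2 s.2), add_sub_cancel] at this
  exact this

theorem ae_eq_arPath_zero (hx : IsStationaryAR1 P ψ θ ε x) (t : ℤ) (n : ℕ) :
    (fun ω => x (t + n) ω - θ ^ n * x t ω) =ᵐ[P]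
      fun ω => arPath ψ θ 0 (innovations ε t ω) n := by
  filter_upwards [ae_eq_arPath hx.recursion] with ω hω
  rw [hω t n, arPath_eq]
  ring

/-- The aggregate of the first `n` innovations after time `t` is independent of the later ones. -/
theorem indepFun_arPath_innovations
    (hind : ∀ t, IndepFun (past x t) (innovations ε t) P)
    (hx : IsStationaryAR1 P ψ θ ε x) (t : ℤ) (n : ℕ) :
    IndepFun (fun ω => arPath ψ θ 0 (innovations ε t ω) n) (innovations ε (t + n)) P := by
  refine IndepFun.congr ?_ (ae_eq_arPath_zero hx t n) EventuallyEq.rfl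
  have hm : Measurable fun p : Set.Iic (t + (n : ℤ)) → ℝ =>
      p ⟨t + n, Set.mem_Iic.2 le_rfl⟩ - θ ^ n * p ⟨t, by simp⟩ := by fun_prop
  exact (hind (t + n)).comp hm measurable_id

/-- Each step adds an independent Gaussian innovation. The form of the variance persists because `τ`
is the fixed point of `τ ↦ θ² τ + σ²`. -/
theorem exists_map_arPath_eq_gaussianReal [IsProbabilityMeasure P]
    (hθ : |θ| < 1)
    (hl : ∀ t, HasLaw (ε t) (gaussianReal 0 σsq) P)
    (hind : ∀ t, IndepFun (past x t) (innovations ε t) P)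
    (hx : IsStationaryAR1 P ψ θ ε x) {τ : ℝ≥0} (hτ : (τ : ℝ) = σsq / (1 - θ ^ 2)) (t : ℤ) (n : ℕ) :
    ∃ v : ℝ≥0, (v : ℝ) = (1 - (θ ^ n) ^ 2) * τ ∧
      P.map (fun ω => arPath ψ θ 0 (innovations ε t ω) n) =
        gaussianReal (ψ / (1 - θ) - θ ^ n * (ψ / (1 - θ))) v := by
  have h1 : 1 - θ ≠ 0 := by
    have := (abs_lt.1 hθ).2
    linarith
  have h2 : 1 - θ ^ 2 ≠ 0 := by
    have := (sq_lt_one_iff_abs_lt_one θ).2 hθ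
    linarith
  induction n with
  | zero =>
    refine ⟨0, by simp, ?_⟩
    simp [arPath, gaussianReal_zero_var, Measure.map_const]
  | succ n ih =>
    obtain ⟨v, hv, hmap⟩ := ih
    -- A nonzero image measure forces a.e. measurability, since `Measure.map` takes the default
    -- value `0` otherwise.
    have hlaw : HasLaw (fun ω => arPath ψ θ 0 (innovations ε t ω) n)
        (gaussianReal (ψ / (1 - θ) - θ ^ n * (ψ / (1 - θ))) v) P :=
      ⟨AEMeasurable.of_map_ne_zero (by rw [hmap]; exact NeZero.ne _), hmap⟩
    have hlaw' := gaussianReal_const_add (gaussianReal_const_mul hlaw θ) ψ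
    have hm : Measurable fun e : ℕ → ℝ => e 0 := measurable_pi_apply 0
    have hi := (indepFun_arPath_innovations hind hx t n).comp
      (φ := fun y => ψ + θ * y) (by fun_prop) hm
    have hadd := gaussianReal_add_gaussianReal_of_indepFun hi hlaw'.map_eq
      (by simpa [innovations, Function.comp_def] using (hl (t + n + 1)).map_eq)
    refine ⟨NNReal.mk (θ ^ 2) (sq_nonneg θ) * v + σsq, ?_, Eq.trans ?_ (hadd.trans ?_)⟩
    · have e : (σsq : ℝ) = (1 - θ ^ 2) * τ := by rw [hτ]; field_simp
      push_cast
      rw [hv, e]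
      ring
    · congr 1
      funext ω
      simp only [arPath, Pi.add_apply, Function.comp_apply, innovations]
      rw [show t + 1 + (n : ℤ) = t + n + 1 + (0 : ℕ) by push_cast; ring]
    · congr 1
      field_simp
      ring

/-- By stationarity, the characteristic function satisfies `φ u = φ (θ ^ n * u)` times a Gaussian
factor for every `n`. As `n → ∞`, continuity and `φ 0 = 1` leave the limit of that factor. -/
theorem IsStationaryAR1.map_eq_gaussianReal [IsProbabilityMeasure P]
    (hθ : |θ| < 1)
    (hl : ∀ t, HasLaw (ε t) (gaussianReal 0 σsq) P)
    (hind : ∀ t, IndepFun (past x t) (innovations ε t) P)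
    (hx : IsStationaryAR1 P ψ θ ε x) {τ : ℝ≥0} (hτ : (τ : ℝ) = σsq / (1 - θ ^ 2)) (t : ℤ) :
    P.map (x t) = gaussianReal (ψ / (1 - θ)) τ := by
  have := Measure.isProbabilityMeasure_map (μ := P) (hx.measurable t).aemeasurable
  refine Measure.ext_of_charFun ?_
  funext u
  set m := ψ / (1 - θ)
  set φ := charFun (P.map (x t)) with hφ
  have hpow := tendsto_pow_atTop_nhds_zero_of_abs_lt_one hθ
  have key : ∀ n : ℕ, φ u = φ (θ ^ n * u) *
      Complex.exp (u * ((m - θ ^ n * m : ℝ) : ℂ) * Complex.I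
        - (((1 - (θ ^ n) ^ 2) * τ : ℝ) : ℂ) * u ^ 2 / 2) := by
    intro n
    obtain ⟨v, hv, hmap⟩ := exists_map_arPath_eq_gaussianReal hθ hl hind hx hτ t n
    have hm0 : Measurable fun p : Set.Iic t → ℝ => θ ^ n * p ⟨t, Set.mem_Iic.2 le_rfl⟩ := by
      fun_prop
    have hm1 : Measurable fun e : ℕ → ℝ => arPath ψ θ 0 e n :=
      (measurable_arPath ψ θ n).comp measurable_prodMk_left
    have hi : IndepFun (fun ω => θ ^ n * x t ω) (fun ω => arPath ψ θ 0 (innovations ε t ω) n) P :=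
      (hind t).comp hm0 hm1
    have hsum : P.map (x t) =
        P.map fun ω => θ ^ n * x t ω + arPath ψ θ 0 (innovations ε t ω) n := by
      rw [← hx.stationary.map_eq hx.measurable (t + n) t]
      refine Measure.map_congr ?_
      filter_upwards [ae_eq_arPath_zero hx t n] with ω hω
      rw [← hω]
      ring
    rw [hφ]
    conv_lhs => rw [hsum]
    rw [hi.charFun_map_fun_add_eq_mul ((hx.measurable t).const_mul _).aemeasurable
      (AEMeasurable.of_map_ne_zero (by rw [hmap]; exact NeZero.ne _)), Pi.mul_apply, hmap,
      charFun_gaussianReal, ← hv]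
    congr 1
    have : P.map (fun ω => θ ^ n * x t ω) = (P.map (x t)).map fun y => θ ^ n * y := by
      rw [Measure.map_map (by fun_prop) (hx.measurable t)]
      rfl
    rw [this, charFun_map_mul]
  have hlim : Tendsto (fun n : ℕ => φ (θ ^ n * u) *
      Complex.exp (u * ((m - θ ^ n * m : ℝ) : ℂ) * Complex.I
        - (((1 - (θ ^ n) ^ 2) * τ : ℝ) : ℂ) * u ^ 2 / 2)) atTop
      (𝓝 (φ (0 * u) * Complex.exp (u * ((m - 0 * m : ℝ) : ℂ) * Complex.I
        - (((1 - 0 ^ 2) * τ : ℝ) : ℂ) * u ^ 2 / 2))) := by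
    have hc : Continuous fun a : ℝ => φ (a * u) *
      Complex.exp (u * ((m - a * m : ℝ) : ℂ) * Complex.I
        - (((1 - a ^ 2) * τ : ℝ) : ℂ) * u ^ 2 / 2) := by
      have : Continuous φ := continuous_charFun
      fun_prop
    exact (hc.tendsto 0).comp hpow
  have h := tendsto_nhds_unique (tendsto_const_nhds (x := φ u)) (hlim.congr fun n => (key n).symm)
  rw [h, charFun_gaussianReal]
  simp [hφ]

/-- The `k`-th `β`-mixing coefficient, before replacing `1 - θ ^ (2 * k)` by `1 - θ ^ 2`. -/
theorem IsStationaryAR1.betaCoeff_le [IsProbabilityMeasure P]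
    (hθ : |θ| < 1) (hε : ∀ t, Measurable (ε t))
    (hl : ∀ t, HasLaw (ε t) (gaussianReal 0 σsq) P)
    (hind : ∀ t, IndepFun (past x t) (innovations ε t) P)
    (hx : IsStationaryAR1 P ψ θ ε x) {k : ℕ} (hk : k ≠ 0) :
    betaCoeff P x k ≤ ENNReal.ofReal (|θ ^ k| / (2 * √(1 - (θ ^ k) ^ 2))) := by
  have h2 : 0 < 1 - θ ^ 2 := by
    have := (sq_lt_one_iff_abs_lt_one θ).2 hθ
    linarith
  obtain ⟨τ, hτ⟩ : ∃ τ : ℝ≥0, (τ : ℝ) = σsq / (1 - θ ^ 2) := ⟨⟨_, by positivity⟩, rfl⟩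
  refine iSup_le fun t => ?_
  set u : ℤ := t + k
  have hEu := measurable_innovations hε u
  have hEt := measurable_innovations hε t
  set η := P.map (innovations ε u)
  have : IsProbabilityMeasure η := Measure.isProbabilityMeasure_map hEu.aemeasurable
  set m := ψ / (1 - θ)
  obtain ⟨v, hv, hmap⟩ := exists_map_arPath_eq_gaussianReal hθ hl hind hx hτ t k
  -- This needs `k ≠ 0`: at `k = 0` the correlation is one, and the claimed bound would be `1 / 0 =
  -- 0`.
  have hρ : |θ ^ k| < 1 := by
    rw [abs_pow]
    exact pow_lt_one₀ (abs_nonneg _) hθ hk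
  obtain ⟨D, hDm, hDle, hD⟩ := exists_gaussian_tv_bound m hρ hv η
  have hZ : Measurable fun ω => arPath ψ θ 0 (innovations ε t ω) k :=
    (measurable_arPath ψ θ k).comp (measurable_const.prodMk hEt)
  set W : Ω → ℝ × (ℕ → ℝ) := fun ω => (arPath ψ θ 0 (innovations ε t ω) k, innovations ε u ω)
    with hW
  have hWm : Measurable W := hZ.prodMk hEu
  have hWlaw : P.map W = (gaussianReal (m - θ ^ k * m) v).prod η := by
    rw [← hmap]
    exact (indepFun_iff_map_prod_eq_prod_map_map hZ.aemeasurable hEu.aemeasurable).1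
      (indepFun_arPath_innovations hind hx t k)
  have hindW : IndepFun (past x t) W P := by
    have hm : Measurable fun e : ℕ → ℝ => (arPath ψ θ 0 e k, fun n : ℕ => e (k + n)) :=
      ((measurable_arPath ψ θ k).comp measurable_prodMk_left).prodMk
        (measurable_pi_lambda _ fun n => measurable_pi_apply _)
    have := (hind t).comp measurable_id hm
    refine this.congr EventuallyEq.rfl (ae_of_all _ fun ω => ?_)
    simp only [Function.comp_apply, hW, Prod.mk.injEq, true_and]
    funext n
    simp only [innovations, u]
    congr 1
    push_cast
    ring
  -- The Markov property: the past enters the future only through its last value.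
  set f : (Set.Iic t → ℝ) × (ℝ × (ℕ → ℝ)) → (Set.Ici u → ℝ) := fun z =>
    arFuture ψ θ u (θ ^ k * z.1 ⟨t, Set.mem_Iic.2 le_rfl⟩ + z.2.1, z.2.2) with hf
  have hg : ∀ y : ℝ, Measurable fun w : ℝ × (ℕ → ℝ) => (θ ^ k * y + w.1, w.2) := fun y => by
    fun_prop
  have hfm : Measurable f := by
    refine (measurable_arFuture ψ θ u).comp (Measurable.prodMk ?_ (by fun_prop))
    have : Measurable fun z : (Set.Iic t → ℝ) × (ℝ × (ℕ → ℝ)) => z.1 ⟨t, Set.mem_Iic.2 le_rfl⟩ :=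
      (measurable_pi_apply _).comp measurable_fst
    fun_prop
  have hfut : future x u =ᵐ[P] fun ω => f (past x t ω, W ω) := by
    filter_upwards [future_ae_eq_arFuture hx u, ae_eq_arPath_zero hx t k] with ω h1 h2
    rw [h1, hf]
    simp only [hW, ← h2, past]
    rw [add_sub_cancel]
  have hcond := condDistrib_comp_prodMk_of_indepFun (measurable_past hx.measurable t) hWm hindW hfm
  rw [← condDistrib_congr_left hfut] at hcond
  have hcond' := ae_of_ae_map (measurable_past hx.measurable t).aemeasurable hcond
  have hxlaw := hx.map_eq_gaussianReal hθ hl hind hτ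
  have hfutlaw : P.map (future x u) =
      ((gaussianReal m τ).prod η).map (arFuture ψ θ u) := by
    have hiu : IndepFun (x u) (innovations ε u) P :=
      (hind u).comp (φ := fun p : Set.Iic u → ℝ => p ⟨u, Set.mem_Iic.2 le_rfl⟩) (measurable_pi_apply _)
        measurable_id
    rw [Measure.map_congr (future_ae_eq_arFuture hx u), ← hxlaw u,
      ← (indepFun_iff_map_prod_eq_prod_map_map (hx.measurable u).aemeasurable
        hEu.aemeasurable).1 hiu,
      Measure.map_map (measurable_arFuture ψ θ u) ((hx.measurable u).prodMk hEu)]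
    rfl
  have hae : ∀ {q : ℝ → Prop}, (∀ᵐ y ∂gaussianReal m τ, q y) → ∀ᵐ ω ∂P, q (x t ω) := fun h =>
    ae_of_ae_map (hx.measurable t).aemeasurable (by rwa [hxlaw t])
  calc _ ≤ ∫⁻ ω, ENNReal.ofReal (D (x t ω)) ∂P := by
        refine lintegral_mono_ae ?_
        filter_upwards [hcond', hae hD] with ω h1 h2
        -- The exceptional null sets were fixed before `B`, so the bound holds for all events
        -- simultaneously and passes to the supremum.
        refine iSup₂_le fun B hB => ENNReal.ofReal_le_ofReal ?_
        have hC := measurable_arFuture ψ θ u hB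
        refine le_trans (le_of_eq ?_) (h2 _ hC)
        have hprod : (gaussianReal (m + θ ^ k * (x t ω - m)) v).prod η =
            (P.map W).map fun w => (θ ^ k * x t ω + w.1, w.2) := by
          have : (fun w : ℝ × (ℕ → ℝ) => (θ ^ k * x t ω + w.1, w.2)) =
              Prod.map (fun y => θ ^ k * x t ω + y) id := rfl
          rw [hWlaw, this, ← Measure.map_prod_map _ _ (by fun_prop) measurable_id,
            gaussianReal_map_const_add, Measure.map_id]
          congr 2
          ring
        have e1 : condProb P x t u B ω =
            ((gaussianReal (m + θ ^ k * (x t ω - m)) v).prod η).real (arFuture ψ θ u ⁻¹' B) := by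
          rw [condProb, h1, hprod, ← map_measureReal_apply (measurable_arFuture ψ θ u) hB,
            Measure.map_map (measurable_arFuture ψ θ u) (hg _)]
          rfl
        have e2 : P.real (future x u ⁻¹' B) =
            ((gaussianReal m τ).prod η).real (arFuture ψ θ u ⁻¹' B) := by
          rw [← map_measureReal_apply (measurable_future hx.measurable u) hB, hfutlaw,
            map_measureReal_apply (measurable_arFuture ψ θ u) hB]
        rw [e1, e2]
    _ = ∫⁻ y, ENNReal.ofReal (D y) ∂gaussianReal m τ := by
        rw [← hxlaw t, lintegral_map hDm.ennreal_ofReal (hx.measurable t)]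
    _ ≤ _ := hDle

/-! ### The exponential rate -/

theorem abs_pow_div_le (hθ : |θ| < 1) {k : ℕ} (hk : 1 ≤ k) :
    |θ ^ k| / (2 * √(1 - (θ ^ k) ^ 2)) ≤ |θ| ^ k / (2 * √(1 - θ ^ 2)) := by
  have h : θ ^ 2 < 1 := (sq_lt_one_iff_abs_lt_one θ).2 hθ
  have h2 : 0 < √(1 - θ ^ 2) := Real.sqrt_pos.2 (by linarith)
  have hp : (θ ^ k) ^ 2 ≤ θ ^ 2 := by
    rw [← pow_mul, mul_comm, pow_mul]
    exact pow_le_of_le_one (sq_nonneg _) h.le (by omega)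
  rw [abs_pow]
  gcongr

theorem abs_pow_div_eq_exp (hθ0 : θ ≠ 0) (k : ℕ) : |θ| ^ k / (2 * √(1 - θ ^ 2)) =
    (2 * √(1 - θ ^ 2))⁻¹ * Real.exp (-(k : ℝ) * Real.log (1 / |θ|)) := by
  have h : Real.exp (-(k : ℝ) * Real.log (1 / |θ|)) = |θ| ^ k := by
    rw [one_div, Real.log_inv, neg_mul_neg, Real.exp_nat_mul, Real.exp_log (abs_pos.2 hθ0)]
  rw [h, div_eq_mul_inv, mul_comm]

theorem isBetaMixing_of_betaCoeff_le [IsProbabilityMeasure P] (hθ : |θ| < 1) (h : ∀ k : ℕ, 1 ≤ k →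
    betaCoeff P x k ≤ ENNReal.ofReal (|θ| ^ k / (2 * √(1 - θ ^ 2)))) : IsBetaMixing P x := by
  have hlim : Tendsto (fun k : ℕ => ENNReal.ofReal (|θ| ^ k / (2 * √(1 - θ ^ 2)))) atTop (𝓝 0) := by
    have := ENNReal.tendsto_ofReal
      ((tendsto_pow_atTop_nhds_zero_of_lt_one (abs_nonneg θ) hθ).div_const (2 * √(1 - θ ^ 2)))
    simpa using this
  refine tendsto_of_tendsto_of_tendsto_of_le_of_le' tendsto_const_nhds hlim
    (Eventually.of_forall fun _ => zero_le) ?_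
  filter_upwards [eventually_ge_atTop 1] with k hk using h k hk

theorem exists_exp_rate [IsProbabilityMeasure P] (hθ : |θ| < 1) (h : ∀ k : ℕ, 1 ≤ k →
    betaCoeff P x k ≤ ENNReal.ofReal (|θ| ^ k / (2 * √(1 - θ ^ 2)))) :
    ∃ C γ ξ : ℝ, 0 < C ∧ 0 < γ ∧ 0 < ξ ∧ ∀ k : ℕ, 1 ≤ k →
      betaCoeff P x k ≤ ENNReal.ofReal (C * Real.exp (-γ * (k : ℝ) ^ ξ)) := by
  by_cases h0 : θ = 0
  -- For `θ = 0` the rate `log (1 / |θ|)` degenerates to `0` in Lean, but the bound vanishes for `k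
  -- ≥ 1`, so any positive constants serve.
  · refine ⟨1, 1, 1, one_pos, one_pos, one_pos, fun k hk => (h k hk).trans ?_⟩
    rw [h0, abs_zero, zero_pow (by omega), zero_div, ENNReal.ofReal_zero]
    exact zero_le
  · have h2 : 0 < √(1 - θ ^ 2) :=
      Real.sqrt_pos.2 (by linarith [(sq_lt_one_iff_abs_lt_one θ).2 hθ])
    refine ⟨(2 * √(1 - θ ^ 2))⁻¹, Real.log (1 / |θ|), 1, by positivity, ?_, one_pos,
      fun k hk => (h k hk).trans (le_of_eq ?_)⟩
    · exact Real.log_pos ((one_lt_div (abs_pos.2 h0)).2 hθ)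
    · rw [abs_pow_div_eq_exp h0, Real.rpow_one]
      congr 3
      ring

end BetaMixing

end

open BetaMixing in
theorem mainTheorem11 {Ω : Type*} [MeasurableSpace Ω] (P : Measure Ω) [IsProbabilityMeasure P]
    (ψ θ : ℝ) (hθ : -1 < θ ∧ θ < 1) (σsq : ℝ≥0) (ε : ℤ → Ω → ℝ)
    (hε_meas : ∀ t, Measurable (ε t)) (hε_indep : iIndepFun ε P)
    (hε_law : ∀ t, HasLaw (ε t) (gaussianReal 0 σsq) P) :
    (∃ x : ℤ → Ω → ℝ, IsStationaryAR1 P ψ θ ε x) ∧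
    (∀ x x' : ℤ → Ω → ℝ, IsStationaryAR1 P ψ θ ε x → IsStationaryAR1 P ψ θ ε x' →
      ∀ t, x t =ᵐ[P] x' t) ∧
    (∀ x : ℤ → Ω → ℝ, IsStationaryAR1 P ψ θ ε x →
      IsBetaMixing P x ∧
      (∀ k : ℕ, 1 ≤ k →
        betaCoeff P x k ≤ ENNReal.ofReal (|θ| ^ k / (2 * √(1 - θ ^ 2)))) ∧
      IsExpBetaMixing P x) ∧
    (θ ≠ 0 → ∀ k : ℕ, |θ| ^ k / (2 * √(1 - θ ^ 2)) =
      (2 * √(1 - θ ^ 2))⁻¹ * Real.exp (-(k : ℝ) * Real.log (1 / |θ|))) := by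
  have hθ' : |θ| < 1 := abs_lt.2 hθ
  have hν : Integrable id (gaussianReal 0 σsq) :=
    memLp_one_iff_integrable.1 (memLp_id_gaussianReal 1)
  refine ⟨⟨_, isStationaryAR1_arSolution hν hθ' hε_meas hε_indep hε_law⟩,
    fun x x' hx hx' t => hx.ae_eq hθ' hx' t, fun x hx => ?_,
    fun h0 k => abs_pow_div_eq_exp h0 k⟩
  have hind := hx.indepFun_past_innovations hν hθ' hε_meas hε_indep hε_law
  have hβ : ∀ k : ℕ, 1 ≤ k →
      betaCoeff P x k ≤ ENNReal.ofReal (|θ| ^ k / (2 * √(1 - θ ^ 2))) := fun k hk =>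
    (hx.betaCoeff_le hθ' hε_meas hε_law hind (by omega)).trans
      (ENNReal.ofReal_le_ofReal (abs_pow_div_le hθ' hk))
  have hmix := isBetaMixing_of_betaCoeff_le hθ' hβ
  exact ⟨hmix, hβ, hx.stationary,
    ⟨P.map (x 0), Measure.isProbabilityMeasure_map (hx.measurable 0).aemeasurable, fun t =>
      ⟨(hx.measurable t).aemeasurable, hx.stationary.map_eq hx.measurable t 0⟩⟩,
    hmix, exists_exp_rate hθ' hβ⟩
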